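/- Let $P=\mathbb Z^{\aleph_0}$ be the Baer--Specker group of all integer sequences under pointwise addition, let $S=\mathbb Z^{(\aleph_0)}\subseteq P$ be the subgroup of sequences with finite support, and let $D$ be the closure of $S$ in $P$ in the $\mathbb Z$-adic topology (the topology in which the cosets $x+nP$, $n\ge 1$, form a neighbourhood basis at $x$). A subgroup $G\subseteq H$ is pure in $H$ if $nH\cap G=nG$ for every integer $n$. For an abelian group $G$ let $\operatorname{Fin}G$ be the group of endomorphisms of $G$ whose image has finite (torsion-free) rank; an endomorphism of $G$ is almost scalar if it differs from multiplication by some integer by an element of $\operatorname{Fin}G$. **Theorem.** Assume the continuum hypothesis $2^{\aleph_0}=\aleph_1$. Then there is a group $G$ such that (a) $S\subseteq G\subseteq D$, and $G$ is pure in $D$ and also pure in $P$; (b) every endomorphism of $G$ is almost scalar, and in fact $\operatorname{End}G=\mathbb Z\oplus\operatorname{Fin}G$, i.e. the map sending an integer to multiplication by it embeds $\mathbb Z$ in $\operatorname{End}G$, and $\operatorname{End}G$ is the internal direct sum of the image of this map and $\operatorname{Fin}G$; (c) the dual group $G^*=\operatorname{Hom}(G,\mathbb Z)$ is uncountable. Consequently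 this $G$ has no direct summand isomorphic to $S$, and $G^*$ is not isomorphic to $S$. So, under the continuum hypothesis, a pure subgroup of $P$ without a direct summand isomorphic to $S$ need not have a dual isomorphic to $S$, which answers Irwin's question negatively. -/

import Mathlib

/-- The Baer–Specker group `P = ℤ^ℵ₀` of all integer sequences, with pointwise addition. -/
abbrev BaerSpecker : Type := ℕ → ℤ

/-- The subgroup `S = ℤ^(ℵ₀)` of `P`: the sequences with finite support. -/
def finSuppSubgroup : AddSubgroup BaerSpecker where
  carrier := {x | (Function.support x).Finite}
  zero_mem' := by simp
  add_mem' := fun {a b} ha hb => (ha.union hb).subset (Function.support_add a b)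
  neg_mem' := fun {a} ha => by simpa [Function.support_neg] using ha

/-- The `ℤ`-adic topology on an abelian group `A`: the cosets `x + nA` with `n ≥ 1` form a
neighbourhood basis at `x`. -/
@[reducible] def zadicTopology (A : Type*) [AddCommGroup A] : TopologicalSpace A where
  IsOpen U := ∀ x ∈ U, ∃ n : ℕ, 0 < n ∧ ∀ y : A, x + n • y ∈ U
  isOpen_univ := fun _ _ => ⟨1, one_pos, fun _ => trivial⟩
  isOpen_inter := by
    rintro U V hU hV x ⟨hxU, hxV⟩
    obtain ⟨n, hn, hn'⟩ := hU x hxU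
    obtain ⟨m, hm, hm'⟩ := hV x hxV
    refine ⟨n * m, Nat.mul_pos hn hm, fun y => ⟨?_, ?_⟩⟩
    · rw [mul_smul]; exact hn' _
    · rw [mul_comm, mul_smul]; exact hm' _
  isOpen_sUnion := by
    rintro s hs x ⟨U, hU, hxU⟩
    obtain ⟨n, hn, hn'⟩ := hs U hU x hxU
    exact ⟨n, hn, fun y => ⟨U, hU, hn' y⟩⟩

/-- `x` lies in the `ℤ`-adic closure of `s` iff `s` meets every coset `x + nA`, `n ≥ 1`. -/
theorem mem_zadic_closure_iff {A : Type*} [AddCommGroup A] {s : Set A} {x : A} :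
    x ∈ @closure A (zadicTopology A) s ↔ ∀ n : ℕ, 0 < n → ∃ y : A, x + n • y ∈ s := by
  let _ := zadicTopology A
  rw [mem_closure_iff]
  constructor
  · intro h n hn
    obtain ⟨z, ⟨y, rfl⟩, hz⟩ := h (Set.range fun y : A => x + n • y)
      (by
        rintro _ ⟨y, rfl⟩
        exact ⟨n, hn, fun w => ⟨y + w, by simp [smul_add, add_assoc]⟩⟩)
      ⟨0, by simp⟩
    exact ⟨y, hz⟩
  · intro h U hU hx
    obtain ⟨n, hn, hn'⟩ := hU x hx
    obtain ⟨y, hy⟩ := h n hn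
    exact ⟨_, hn' y, hy⟩

/-- The closure of a subgroup in the `ℤ`-adic topology, as a subgroup. -/
def zadicClosure {A : Type*} [AddCommGroup A] (H : AddSubgroup A) : AddSubgroup A where
  carrier := @closure A (zadicTopology A) (H : Set A)
  zero_mem' := mem_zadic_closure_iff.2 fun _ _ => ⟨0, by simp⟩
  add_mem' := by
    intro a b ha hb
    rw [mem_zadic_closure_iff] at *
    intro n hn
    obtain ⟨y, hy⟩ := ha n hn
    obtain ⟨z, hz⟩ := hb n hn
    refine ⟨y + z, ?_⟩
    have := H.add_mem hy hz
    rwa [add_add_add_comm, ← smul_add] at this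
  neg_mem' := by
    intro a ha
    rw [mem_zadic_closure_iff] at *
    intro n hn
    obtain ⟨y, hy⟩ := ha n hn
    refine ⟨-y, ?_⟩
    have := H.neg_mem hy
    rwa [neg_add, ← smul_neg] at this

/-- `G` is a pure subgroup of `D`: `G ≤ D` and `nD ∩ G = nG` for every integer `n`. -/
def IsPureIn {A : Type*} [AddCommGroup A] (G D : AddSubgroup A) : Prop :=
  G ≤ D ∧ ∀ (n : ℤ), ∀ d ∈ D, n • d ∈ G → ∃ g ∈ G, n • g = n • d

/-- A homomorphism of abelian groups whose image has finite (torsion-free) rank, the rank being the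
maximal number of elements that are linearly independent over `ℤ`. -/
def HasFiniteRank {A B : Type*} [AddCommGroup A] [AddCommGroup B] (f : A →+ B) : Prop :=
  LinearMap.rank f.toIntLinearMap < Cardinal.aleph0

/-- `Fin G`: the endomorphisms of `G` of finite rank, as a subgroup of `End G`. -/
def finEnd (G : Type*) [AddCommGroup G] : AddSubgroup (AddMonoid.End G) where
  carrier := {f | HasFiniteRank (A := G) (B := G) f}
  zero_mem' := by
    change LinearMap.rank (0 : G →ₗ[ℤ] G) < Cardinal.aleph0
    rw [LinearMap.rank_zero]
    exact Cardinal.aleph0_pos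
  add_mem' := by
    intro f g hf hg
    have hle : LinearMap.range (AddMonoidHom.toIntLinearMap (f + g : G →+ G)) ≤
        LinearMap.range (AddMonoidHom.toIntLinearMap (f : G →+ G)) ⊔
          LinearMap.range (AddMonoidHom.toIntLinearMap (g : G →+ G)) := by
      rintro _ ⟨x, rfl⟩
      exact Submodule.add_mem_sup ⟨x, rfl⟩ ⟨x, rfl⟩
    exact ((Submodule.rank_mono hle).trans
      (Submodule.rank_add_le_rank_add_rank _ _)).trans_lt (Cardinal.add_lt_aleph0 hf hg)
  neg_mem' := by
    intro f hf
    change LinearMap.rank (-(AddMonoidHom.toIntLinearMap (f : G →+ G))) < Cardinal.aleph0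
    rw [LinearMap.rank, LinearMap.range_neg]
    exact hf

/-- The scalar endomorphisms of `G`, i.e. the multiplications by integers. -/
def scalarEnd (G : Type*) [AddCommGroup G] : AddSubgroup (AddMonoid.End G) :=
  (Int.castRingHom (AddMonoid.End G)).range.toAddSubgroup

/-- An endomorphism is almost scalar if it differs from the multiplication by some integer by an
endomorphism of finite rank. -/
def IsAlmostScalar {G : Type*} [AddCommGroup G] (f : AddMonoid.End G) : Prop :=
  ∃ z : ℤ, f - (z : AddMonoid.End G) ∈ finEnd G

/-- `End G = ℤ ⊕ Fin G`: the map `ℤ → End G` is injective, so that its image `scalarEnd G` is a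
copy of `ℤ`, and `End G` is the internal direct sum of `scalarEnd G` and `Fin G`. -/
def EndEqIntSumFin (G : Type*) [AddCommGroup G] : Prop :=
  Function.Injective (Int.castRingHom (AddMonoid.End G)) ∧ IsCompl (scalarEnd G) (finEnd G)

/-- `G` has a direct summand isomorphic to `H`. -/
def HasSummandIso (G H : Type*) [AddCommGroup G] [AddCommGroup H] : Prop :=
  ∃ A B : AddSubgroup G, IsCompl A B ∧ Nonempty (A ≃+ H)

/-! Only zero in `P` is divisible by every positive integer, and `S` is dense in `D`; so for pure
`G` between `S` and `D`, an endomorphism is determined by the images `v i` of the unit vectors.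
There are continuum many such `v`, and under CH they are well-ordered with countable initial
segments, so unwanted `v` can be excluded one at a time.

Stage `v` produces a sequence `x`, put into `G`, and a sequence `b` that must pair integrally with
all of `G`. If `v` is not a rational scalar on any part of `S` cut out by finitely many functionals,
a diagonal choice of `x` forces its image out of the pure hull of the elements so far
(`exists_notMem_pureHull`); `b` is then integral on that hull but not at the image
(`exists_pairsIntegrally`), so the image can never enter `G`. Both choices come from
`exists_diagonal`, the pairing being symmetric.

A surviving endomorphism equals an integer `z` on such a part of `S`
(`exists_scalar_of_not_avoidsScalars`), and density makes its difference from `z` of finite rank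
(`hasFiniteRank_of_ker`). The distinct `b` give uncountably many functionals on `G`. A summand `S`
would carry a shift, which is not almost scalar. -/

/-- The pairing `s ↦ ∑ aᵢ sᵢ` of an integer sequence with finitely supported sequences. -/
noncomputable def seqPairing (a : BaerSpecker) : (ℕ →₀ ℤ) →ₗ[ℤ] ℤ := Finsupp.linearCombination ℤ a

/-- The inclusion of the finitely supported sequences into all sequences. -/
noncomputable def finsuppToSeq : (ℕ →₀ ℤ) →ₗ[ℤ] BaerSpecker := Finsupp.lcoeFun

/-- The `i`-th unit vector. -/
def unitSeq (i : ℕ) : BaerSpecker := Pi.single i 1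

/-- The series `∑ aᵢ dᵢ` converges in the `ℤ`-adic topology to an integer. -/
def PairsIntegrally (a d : BaerSpecker) : Prop :=
  ∃ z : ℤ, ∀ M : ℕ, 0 < M → ∃ N, ∀ n ≥ N, (M : ℤ) ∣ ∑ i ∈ Finset.range n, a i * d i - z

@[simp] theorem finsuppToSeq_apply (s : ℕ →₀ ℤ) (i : ℕ) : finsuppToSeq s i = s i := rfl

@[simp] theorem seqPairing_single (a : BaerSpecker) (i : ℕ) (c : ℤ) :
    seqPairing a (Finsupp.single i c) = c * a i := by
  simp [seqPairing]

theorem seqPairing_unitSeq (i : ℕ) (s : ℕ →₀ ℤ) : seqPairing (unitSeq i) s = s i := by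
  induction s using Finsupp.induction_linear with
  | zero => simp
  | add f g hf hg => simp [hf, hg]
  | single j c => simp [unitSeq, Pi.single_apply, Finsupp.single_apply, eq_comm]

theorem seqPairing_eq_sum_range (a : BaerSpecker) (s : ℕ →₀ ℤ) :
    ∃ N, ∀ n ≥ N, ∑ i ∈ Finset.range n, a i * s i = seqPairing a s := by
  refine ⟨s.support.sup id + 1, fun n hn => ?_⟩
  rw [seqPairing, Finsupp.linearCombination_apply, Finsupp.sum_of_support_subset s (s := Finset.range n)]
  · exact Finset.sum_congr rfl fun i _ => by rw [smul_eq_mul, mul_comm]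
  · intro i hi
    have := Finset.le_sup (f := id) hi
    simp only [id] at this
    exact Finset.mem_range.2 (by omega)
  · simp

theorem eq_zero_of_forall_dvd {z : ℤ} (h : ∀ M : ℕ, 0 < M → (M : ℤ) ∣ z) : z = 0 := by
  by_contra hz
  have h1 := h (z.natAbs + 1) (by omega)
  have := Int.natAbs_dvd_natAbs.2 h1
  have := Nat.le_of_dvd (Int.natAbs_pos.2 hz) this
  rw [Int.natAbs_natCast] at this
  omega

theorem exists_not_smul {w : BaerSpecker} (hw : w ≠ 0) :
    ∃ M : ℕ, 0 < M ∧ ∀ v : BaerSpecker, w ≠ M • v := by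
  by_contra! h
  apply hw
  ext i
  refine eq_zero_of_forall_dvd fun M hM => ?_
  obtain ⟨v, rfl⟩ := h M hM
  exact ⟨v i, by simp⟩

theorem PairsIntegrally.symm {a d : BaerSpecker} (h : PairsIntegrally a d) :
    PairsIntegrally d a := by
  simpa only [PairsIntegrally, mul_comm] using h

/-! ### Diagonal construction of sequences in the closure of `S` -/

/-- The `p k` are approximations to a limit, correct modulo `c k`. Requirement `k` is met at one
finite stage modulo `c (k + 1)`; later corrections are multiples of that modulus and cannot undo it.
-/
theorem exists_diagonal_seq (a : ℕ → BaerSpecker)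
    (ψ : ℕ → (ℕ →₀ ℤ) →ₗ[ℤ] BaerSpecker) (g : ℕ → BaerSpecker)
    (h : ∀ k m, ∃ s, (∀ j < m, seqPairing (a j) s = 0) ∧ (∀ j < m, s j = 0) ∧ ψ k s ≠ 0) :
    ∃ (p : ℕ → ℕ →₀ ℤ) (c : ℕ → ℕ), (∀ k, 0 < c k) ∧ (∀ k, k + 1 ∣ c (k + 1)) ∧
      (∀ k, c k ∣ c (k + 1)) ∧
      (∀ k, ∃ t, p (k + 1) = p k + c k • t ∧ (∀ j < k, seqPairing (a j) t = 0) ∧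
        ∀ j < k, t j = 0) ∧
      ∀ k, ∀ v, ψ k (p (k + 1)) - g k ≠ c (k + 1) • v := by
  have step : ∀ (k : ℕ) (q : {q : (ℕ →₀ ℤ) × ℕ // 0 < q.2}), ∃ q' : {q : (ℕ →₀ ℤ) × ℕ // 0 < q.2},
      (k + 1) ∣ q'.1.2 ∧ q.1.2 ∣ q'.1.2 ∧
      (∃ t, q'.1.1 = q.1.1 + q.1.2 • t ∧ (∀ j < k, seqPairing (a j) t = 0) ∧ ∀ j < k, t j = 0) ∧
      ∀ v, ψ k q'.1.1 - g k ≠ q'.1.2 • v := by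
    rintro k ⟨⟨p, c⟩, hc⟩
    obtain ⟨t, ht0, ht1, ht⟩ : ∃ t, (∀ j < k, seqPairing (a j) t = 0) ∧ (∀ j < k, t j = 0) ∧
        ψ k (p + c • t) - g k ≠ 0 := by
      by_cases h0 : ψ k p - g k = 0
      · obtain ⟨s, hs0, hs1, hs⟩ := h k k
        refine ⟨s, hs0, hs1, ?_⟩
        rw [map_add, add_sub_right_comm, h0, zero_add, map_nsmul]
        exact smul_ne_zero hc.ne' hs
      · exact ⟨0, by simp, by simp, by simpa using h0⟩
    obtain ⟨M, hM, hv⟩ := exists_not_smul ht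
    -- The factor `k + 1` makes the moduli eventually divisible by every positive integer, `c` makes
    -- them a divisibility chain, and `M` witnesses the inequality just obtained.
    refine ⟨⟨⟨p + c • t, (k + 1) * c * M⟩, by simp only; positivity⟩, ?_, ?_, ⟨t, rfl, ht0, ht1⟩, ?_⟩
    · exact ⟨c * M, by simp only; ring⟩
    · exact ⟨(k + 1) * M, by simp only; ring⟩
    · intro v hv'
      apply hv (((k + 1) * c) • v)
      rw [hv', smul_smul, mul_comm M]
  choose f hf1 hf2 hf3 hf4 using step
  let q : ℕ → {q : (ℕ →₀ ℤ) × ℕ // 0 < q.2} := fun n => Nat.rec ⟨(0, 1), one_pos⟩ f n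
  exact ⟨fun n => (q n).1.1, fun n => (q n).1.2, fun k => (q k).2, fun k => hf1 k (q k),
    fun k => hf2 k (q k), fun k => hf3 k (q k), fun k => hf4 k (q k)⟩

/-- Diagonal construction of a sequence `x` in the `ℤ`-adic closure of the finitely supported
sequences that pairs integrally with every member of the countable set `A` and whose image under
`ψ` differs from `g`, for each of countably many requirements `(ψ, g)`. -/
theorem exists_diagonal {A : Set BaerSpecker} (hA : A.Countable)
    {R : Set (((ℕ →₀ ℤ) →ₗ[ℤ] BaerSpecker) × BaerSpecker)} (hR : R.Countable)
    (hu : ∀ i, unitSeq i ∈ A) (hne : R.Nonempty)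
    (h : ∀ r ∈ R, ∀ F : Finset BaerSpecker, (∀ a ∈ F, a ∈ A) →
      ∃ s, (∀ a ∈ F, seqPairing a s = 0) ∧ r.1 s ≠ 0) :
    ∃ x : BaerSpecker, (∀ n : ℕ, 0 < n → ∃ (p : ℕ →₀ ℤ) (d : BaerSpecker),
        x = finsuppToSeq p + n • d) ∧
      (∀ a ∈ A, PairsIntegrally a x) ∧
      ∀ r ∈ R, ∃ (p : ℕ →₀ ℤ) (c : ℕ), 0 < c ∧ (∃ d, x = finsuppToSeq p + c • d) ∧
        ∀ v, r.1 p - r.2 ≠ c • v := by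
  classical
  obtain ⟨a, rfl⟩ := hA.exists_eq_range ⟨_, hu 0⟩
  obtain ⟨r, rfl⟩ := hR.exists_eq_range hne
  obtain ⟨p, c, hc, hdvd, hcc, hp, hr⟩ := exists_diagonal_seq a (fun k => (r k).1)
    (fun k => (r k).2) (fun k m => by
      obtain ⟨s, hs, hs'⟩ := h (r k) ⟨k, rfl⟩
        ((Finset.range m).image a ∪ (Finset.range m).image unitSeq) (by
          intro b hb
          simp only [Finset.mem_union, Finset.mem_image] at hb
          rcases hb with ⟨i, -, rfl⟩ | ⟨i, -, rfl⟩
          exacts [⟨i, rfl⟩, hu i])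
      refine ⟨s, fun j hj => hs _ ?_, fun j hj => ?_, hs'⟩
      · exact Finset.mem_union_left _ (Finset.mem_image_of_mem _ (Finset.mem_range.2 hj))
      · rw [← seqPairing_unitSeq]
        exact hs _ (Finset.mem_union_right _ (Finset.mem_image_of_mem _ (Finset.mem_range.2 hj))))
  choose t hpt ht0 ht1 using hp
  have hcm : ∀ k l, k ≤ l → c k ∣ c l := fun k l hkl => by
    induction l, hkl using Nat.le_induction with
    | base => exact dvd_rfl
    | succ l _ ih => exact ih.trans (hcc l)
  have hstable : ∀ i k, i + 1 ≤ k → p k i = p (i + 1) i := fun i k hk => by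
    induction k, hk using Nat.le_induction with
    | base => rfl
    | succ k hk ih => rw [hpt, Finsupp.add_apply, Finsupp.smul_apply, ht1 k i hk, ih]; simp
  have hcong : ∀ k l, k ≤ l → ∀ i, (c k : ℤ) ∣ p l i - p k i := fun k l hkl i => by
    induction l, hkl using Nat.le_induction with
    | base => simp
    | succ l hl ih =>
      rw [hpt, Finsupp.add_apply, Finsupp.smul_apply, add_sub_right_comm]
      refine dvd_add ih ?_
      rw [nsmul_eq_mul]
      exact (Int.natCast_dvd_natCast.2 (hcm k l hl)).mul_right _
  have hpair : ∀ j k, j ≤ k → seqPairing (a j) (p (k + 1)) = seqPairing (a j) (p (j + 1)) :=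
    fun j k hk => by
    induction k, hk using Nat.le_induction with
    | base => rfl
    | succ k hk ih => rw [hpt, map_add, ih, map_nsmul, ht0 (k + 1) j (by omega)]; simp
  -- Coordinate `i` is frozen from stage `i + 1` on, so the limit is the diagonal `p (i + 1) i`.
  have hx : ∀ k, ∃ d : BaerSpecker, (fun i => p (i + 1) i) = finsuppToSeq (p k) + c k • d := by
    intro k
    have : ∀ i, (c k : ℤ) ∣ p (i + 1) i - p k i := fun i => by
      rcases le_total k (i + 1) with hk | hk
      · exact hcong _ _ hk i
      · rw [hstable i k hk, sub_self]; exact dvd_zero _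
    choose d hd using this
    refine ⟨d, funext fun i => ?_⟩
    rw [Pi.add_apply, Pi.smul_apply, finsuppToSeq_apply, nsmul_eq_mul]
    linear_combination hd i
  have hx' : ∀ k m, 0 < m → m ∣ c k → ∃ d : BaerSpecker,
      (fun i => p (i + 1) i) = finsuppToSeq (p k) + m • d := by
    rintro k m hm ⟨e, he⟩
    obtain ⟨d, hd⟩ := hx k
    exact ⟨e • d, by rw [hd, he, mul_smul]⟩
  refine ⟨fun i => p (i + 1) i, fun n hn => ?_, ?_, ?_⟩
  · obtain ⟨m, rfl⟩ := Nat.exists_eq_succ_of_ne_zero hn.ne'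
    exact ⟨_, hx' (m + 1) (m + 1) hn (hdvd m)⟩
  · rintro _ ⟨j, rfl⟩
    refine ⟨seqPairing (a j) (p (j + 1)), fun M hM => ?_⟩
    obtain ⟨m, rfl⟩ := Nat.exists_eq_succ_of_ne_zero hM.ne'
    obtain ⟨d, hd⟩ := hx' (max j m + 1) (m + 1) hM ((hdvd m).trans (hcm _ _ (by omega)))
    obtain ⟨N, hN⟩ := seqPairing_eq_sum_range (a j) (p (max j m + 1))
    refine ⟨N, fun n hn => ?_⟩
    rw [← hpair j (max j m) (le_max_left _ _), ← hN n hn, ← Finset.sum_sub_distrib]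
    refine Finset.dvd_sum fun i _ => ⟨a j i * d i, ?_⟩
    have := congrFun hd i
    rw [Pi.add_apply, Pi.smul_apply, finsuppToSeq_apply, nsmul_eq_mul] at this
    change a j i * p (i + 1) i - _ = _
    rw [this]
    push_cast
    ring
  · rintro _ ⟨k, rfl⟩
    exact ⟨p (k + 1), c (k + 1), hc _, hx _, hr k⟩

/-! ### Rational spans, pure hulls and integral pairings -/

/-- A sequence in the `ℚ`-span of finitely many sequences is detected by finitely supported
functionals. -/
theorem exists_smul_mem_span (F : Finset BaerSpecker) (y : BaerSpecker)
    (h : ∀ s, (∀ a ∈ F, seqPairing a s = 0) → seqPairing y s = 0) :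
    ∃ n : ℤ, n ≠ 0 ∧ n • y ∈ Submodule.span ℤ (F : Set BaerSpecker) := by
  classical
  let L : BaerSpecker → (ℕ →₀ ℚ) →ₗ[ℚ] ℚ := fun a =>
    Finsupp.linearCombination ℚ (fun i => (a i : ℚ))
  -- A nonzero multiple of a rational vector is integral, so the hypothesis on integral `s` controls
  -- the common kernel over `ℚ`.
  have hclear : ∀ u : ℕ →₀ ℚ, ∃ (m : ℤ) (s : ℕ →₀ ℤ), m ≠ 0 ∧
      ∀ a, (m : ℚ) * L a u = (seqPairing a s : ℤ) := by
    intro u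
    induction u using Finsupp.induction_linear with
    | zero => exact ⟨1, 0, one_ne_zero, by simp⟩
    | add f g hf hg =>
      obtain ⟨m, s, hm, hs⟩ := hf
      obtain ⟨m', s', hm', hs'⟩ := hg
      refine ⟨m * m', m' • s + m • s', mul_ne_zero hm hm', fun a => ?_⟩
      simp only [map_add, map_smul, smul_eq_mul, Int.cast_add, Int.cast_mul, ← hs, ← hs']
      ring
    | single i q =>
      refine ⟨q.den, Finsupp.single i q.num, by simp, fun a => ?_⟩
      simp only [L, Finsupp.linearCombination_single, seqPairing_single, smul_eq_mul, Int.cast_mul,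
        Int.cast_natCast]
      rw [← mul_assoc, mul_comm (q.den : ℚ), Rat.mul_den_eq_num]
  have key : L y ∈ Submodule.span ℚ (Set.range fun a : F => L a) := by
    refine mem_span_of_iInf_ker_le_ker fun u hu => ?_
    obtain ⟨m, s, hm, hs⟩ := hclear u
    have h0 : seqPairing y s = 0 := h s fun a ha => by
      have := (Submodule.mem_iInf _).1 hu ⟨a, ha⟩
      rw [LinearMap.mem_ker] at this
      have h1 := hs a
      rw [this, mul_zero] at h1
      exact_mod_cast h1.symm
    have h1 := hs y
    rw [h0, Int.cast_zero] at h1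
    exact (mul_eq_zero.1 h1).resolve_left (by exact_mod_cast hm)
  obtain ⟨q, hq⟩ := (Submodule.mem_span_range_iff_exists_fun ℚ).1 key
  obtain ⟨⟨n, hn⟩, hint⟩ := IsLocalization.exist_integer_multiples_of_finite
    (nonZeroDivisors ℤ) q
  choose z hz using hint
  refine ⟨n, nonZeroDivisors.ne_zero hn, ?_⟩
  have : n • y = ∑ a : F, z a • (a : BaerSpecker) := by
    ext i
    have h1 := congrArg (fun l : (ℕ →₀ ℚ) →ₗ[ℚ] ℚ => l (Finsupp.single i 1)) hq
    simp only [L, LinearMap.sum_apply, LinearMap.smul_apply, Finsupp.linearCombination_single,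
      smul_eq_mul, one_mul] at h1
    have h2 : ((n * y i : ℤ) : ℚ) = ((∑ a : F, z a * (a : BaerSpecker) i : ℤ) : ℚ) := by
      push_cast
      rw [← h1, Finset.mul_sum]
      refine Finset.sum_congr rfl fun a _ => ?_
      have := hz a
      simp only [eq_intCast, zsmul_eq_mul] at this
      rw [this, mul_assoc]
    simpa using (Int.cast_injective h2)
  rw [this]
  exact Submodule.sum_mem _ fun a _ => Submodule.smul_mem _ _ (Submodule.subset_span a.2)

theorem mem_finSuppSubgroup_iff {x : BaerSpecker} :
    x ∈ finSuppSubgroup ↔ ∃ s : ℕ →₀ ℤ, finsuppToSeq s = x := by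
  constructor
  · intro h
    exact ⟨Finsupp.ofSupportFinite x h, rfl⟩
  · rintro ⟨s, rfl⟩
    exact s.hasFiniteSupport

theorem mem_zadicClosure_iff {x : BaerSpecker} :
    x ∈ zadicClosure finSuppSubgroup ↔
      ∀ n : ℕ, 0 < n → ∃ (p : ℕ →₀ ℤ) (d : BaerSpecker), x = finsuppToSeq p + n • d := by
  refine (mem_zadic_closure_iff (s := (finSuppSubgroup : Set BaerSpecker))).trans
    (forall₂_congr fun n _ => ?_)
  constructor
  · rintro ⟨y, hy⟩
    obtain ⟨s, hs⟩ := mem_finSuppSubgroup_iff.1 hy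
    exact ⟨s, -y, by rw [hs]; simp⟩
  · rintro ⟨p, d, rfl⟩
    exact ⟨-d, mem_finSuppSubgroup_iff.2 ⟨p, by simp⟩⟩

/-- The pure subgroup generated by a set of sequences. -/
def pureHull (T : Set BaerSpecker) : AddSubgroup BaerSpecker where
  carrier := {d | ∃ n : ℤ, n ≠ 0 ∧ n • d ∈ Submodule.span ℤ T}
  zero_mem' := ⟨1, one_ne_zero, by simp⟩
  add_mem' := by
    rintro a b ⟨n, hn, ha⟩ ⟨m, hm, hb⟩
    refine ⟨n * m, mul_ne_zero hn hm, ?_⟩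
    rw [smul_add, mul_comm, mul_smul, mul_comm, mul_smul]
    exact add_mem (Submodule.smul_mem _ _ ha) (Submodule.smul_mem _ _ hb)
  neg_mem' := by
    rintro a ⟨n, hn, ha⟩
    exact ⟨n, hn, by rw [smul_neg]; exact neg_mem ha⟩

theorem subset_pureHull (T : Set BaerSpecker) : T ⊆ pureHull T := fun x hx =>
  ⟨1, one_ne_zero, by simpa using Submodule.subset_span hx⟩

theorem mem_pureHull_of_smul_mem {T : Set BaerSpecker} {n : ℤ} {d : BaerSpecker} (hn : n ≠ 0)
    (h : n • d ∈ pureHull T) : d ∈ pureHull T := by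
  obtain ⟨m, hm, h⟩ := h
  exact ⟨m * n, mul_ne_zero hm hn, by rwa [mul_smul]⟩

theorem pureHull_induction {T : Set BaerSpecker} {K : AddSubgroup BaerSpecker} (hT : T ⊆ K)
    (hK : ∀ (n : ℤ) (d : BaerSpecker), n ≠ 0 → n • d ∈ K → d ∈ K) : pureHull T ≤ K := by
  rintro d ⟨n, hn, h⟩
  exact hK n d hn ((Submodule.span_le (p := AddSubgroup.toIntSubmodule K)).2 hT h)

theorem isPureIn_pureHull {T : Set BaerSpecker} {D : AddSubgroup BaerSpecker}
    (h : pureHull T ≤ D) : IsPureIn (pureHull T) D := by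
  refine ⟨h, fun n d _ hnd => ?_⟩
  rcases eq_or_ne n 0 with rfl | hn
  · exact ⟨0, zero_mem _, by simp⟩
  · exact ⟨d, mem_pureHull_of_smul_mem hn hnd, rfl⟩

theorem mem_of_isPureIn_top {H : AddSubgroup BaerSpecker} (hH : IsPureIn H ⊤) {n : ℤ}
    {d : BaerSpecker} (hn : n ≠ 0) (h : n • d ∈ H) : d ∈ H := by
  obtain ⟨g, hg, hgd⟩ := hH.2 n d trivial h
  rwa [← smul_right_injective _ hn hgd]

theorem finsuppToSeq_eq_sum (s : ℕ →₀ ℤ) : finsuppToSeq s = s.sum fun i c => c • unitSeq i := by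
  induction s using Finsupp.induction_linear with
  | zero => simp
  | add f g hf hg => rw [map_add, hf, hg, Finsupp.sum_add_index'] <;> simp [add_mul]
  | single j c =>
    rw [Finsupp.sum_single_index (by simp)]
    ext i
    simp [unitSeq, Pi.single_apply, Finsupp.single_apply, eq_comm]

theorem finsuppToSeq_mem {K : AddSubgroup BaerSpecker} (h : ∀ i, unitSeq i ∈ K) (s : ℕ →₀ ℤ) :
    finsuppToSeq s ∈ K := by
  rw [finsuppToSeq_eq_sum]
  exact sum_mem fun i _ => zsmul_mem (h i) _

/-- The closure of `S` is itself pure in `P`: if `n • d` is finitely supported modulo `m * |n|`,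
cancelling `n` shows that `d` is divisible by `m` off the same finite support. -/
theorem pureHull_le_zadicClosure {T : Set BaerSpecker} (hT : T ⊆ zadicClosure finSuppSubgroup) :
    pureHull T ≤ zadicClosure finSuppSubgroup := by
  refine pureHull_induction hT fun n d hn h => ?_
  rw [mem_zadicClosure_iff] at h ⊢
  intro m hm
  obtain ⟨p, e, h⟩ := h (m * n.natAbs) (Nat.mul_pos hm (Int.natAbs_pos.2 hn))
  classical
  have hd : ∀ i, i ∉ p.support → (m : ℤ) ∣ d i := by
    intro i hi
    have h1 := congrFun h i
    rw [Pi.add_apply, Pi.smul_apply, Pi.smul_apply, finsuppToSeq_apply,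
      Finsupp.notMem_support_iff.1 hi, nsmul_eq_mul, smul_eq_mul, zero_add] at h1
    have h2 : n * (m : ℤ) ∣ n * d i := by
      rw [h1, Nat.cast_mul, mul_comm n]
      exact (mul_dvd_mul_left _ (Int.dvd_natAbs.2 dvd_rfl)).mul_right _
    exact (mul_dvd_mul_iff_left hn).1 h2
  refine ⟨Finsupp.onFinset p.support (fun i => if i ∈ p.support then d i else 0) (by aesop),
    fun i => if i ∈ p.support then 0 else d i / m, funext fun i => ?_⟩
  rw [Pi.add_apply, Pi.smul_apply, finsuppToSeq_apply, nsmul_eq_mul, Finsupp.onFinset_apply]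
  split_ifs with hi
  · simp
  · rw [Int.mul_ediv_cancel' (hd i hi), zero_add]

/-- The sequences pairing integrally with `b`. -/
def integralSubgroup (b : BaerSpecker) : AddSubgroup BaerSpecker where
  carrier := {d | PairsIntegrally b d}
  zero_mem' := ⟨0, fun M _ => ⟨0, fun n _ => by simp⟩⟩
  add_mem' := by
    rintro d e ⟨z, hz⟩ ⟨w, hw⟩
    refine ⟨z + w, fun M hM => ?_⟩
    obtain ⟨N, hN⟩ := hz M hM
    obtain ⟨N', hN'⟩ := hw M hM
    refine ⟨max N N', fun n hn => ?_⟩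
    have := dvd_add (hN n (le_of_max_le_left hn)) (hN' n (le_of_max_le_right hn))
    have hsum : ∑ i ∈ Finset.range n, b i * (d + e) i =
        ∑ i ∈ Finset.range n, b i * d i + ∑ i ∈ Finset.range n, b i * e i := by
      rw [← Finset.sum_add_distrib]
      exact Finset.sum_congr rfl fun i _ => mul_add _ _ _
    rwa [hsum, add_sub_add_comm]
  neg_mem' := by
    rintro d ⟨z, hz⟩
    refine ⟨-z, fun M hM => ?_⟩
    obtain ⟨N, hN⟩ := hz M hM
    refine ⟨N, fun n hn => ?_⟩
    have hsum : ∑ i ∈ Finset.range n, b i * (-d) i = -∑ i ∈ Finset.range n, b i * d i := by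
      rw [← Finset.sum_neg_distrib]
      exact Finset.sum_congr rfl fun i _ => mul_neg _ _
    rw [hsum, ← neg_sub', dvd_neg]
    exact hN n hn

/-- The limit for `m • d` is divisible by `m`, as seen modulo `|m|`; working modulo `|m| * M` then
allows `m` to be cancelled. -/
theorem pairsIntegrally_of_smul {b d : BaerSpecker} {m : ℤ} (hm : m ≠ 0)
    (h : PairsIntegrally b (m • d)) : PairsIntegrally b d := by
  obtain ⟨z, hz⟩ := h
  have hsum : ∀ n, ∑ i ∈ Finset.range n, b i * (m • d) i = m * ∑ i ∈ Finset.range n, b i * d i := by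
    intro n
    rw [Finset.mul_sum]
    exact Finset.sum_congr rfl fun i _ => by rw [Pi.smul_apply, smul_eq_mul]; ring
  obtain ⟨w, rfl⟩ : m ∣ z := by
    obtain ⟨N, hN⟩ := hz m.natAbs (Int.natAbs_pos.2 hm)
    have h1 := Int.natAbs_dvd.1 (hN N le_rfl)
    rw [hsum] at h1
    exact (dvd_sub_right (dvd_mul_right _ _)).1 h1
  refine ⟨w, fun M hM => ?_⟩
  obtain ⟨N, hN⟩ := hz (m.natAbs * M) (Nat.mul_pos (Int.natAbs_pos.2 hm) hM)
  refine ⟨N, fun n hn => ?_⟩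
  have h1 := hN n hn
  rw [hsum, ← mul_sub, Nat.cast_mul] at h1
  exact (mul_dvd_mul_iff_left hm).1 ((mul_dvd_mul_right (Int.dvd_natAbs.2 dvd_rfl) _).trans h1)

theorem pairsIntegrally_unitSeq (b : BaerSpecker) (i : ℕ) : PairsIntegrally b (unitSeq i) := by
  refine ⟨b i, fun M _ => ⟨i + 1, fun n hn => ?_⟩⟩
  have : ∑ j ∈ Finset.range n, b j * unitSeq i j = b i := by
    rw [Finset.sum_eq_single i]
    · simp [unitSeq]
    · intro j _ hj
      simp [unitSeq, hj]
    · intro h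
      exact absurd (Finset.mem_range.2 (by omega)) h
  rw [this, sub_self]
  exact dvd_zero _

theorem pureHull_pairsIntegrally {T : Set BaerSpecker} {b : BaerSpecker}
    (h : ∀ x ∈ T, PairsIntegrally b x) : ∀ x ∈ pureHull T, PairsIntegrally b x :=
  pureHull_induction (K := integralSubgroup b) h fun _ _ hm hd => pairsIntegrally_of_smul hm hd

theorem exists_ne_zero_seqPairing_eq_zero (F : Finset BaerSpecker) :
    ∃ s : ℕ →₀ ℤ, s ≠ 0 ∧ ∀ a ∈ F, seqPairing a s = 0 := by
  by_contra! h
  let L : (ℕ →₀ ℤ) →ₗ[ℤ] (F → ℤ) := LinearMap.pi fun a => seqPairing a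
  have hL : Function.Injective L := by
    rw [← LinearMap.ker_eq_bot, LinearMap.ker_eq_bot']
    intro s hs
    by_contra hs0
    obtain ⟨a, ha, has⟩ := h s hs0
    exact has (congrFun hs ⟨a, ha⟩)
  have h1 := LinearMap.rank_le_of_injective L hL
  have h2 : Module.rank ℤ (F → ℤ) < Cardinal.aleph0 := Module.rank_lt_aleph0 ..
  rw [rank_finsupp_self'] at h1
  exact absurd (h1.trans_lt h2) (by simp)

/-- Countable families admit a new sequence `b`, integral on a given countable set, that is not
integral at a given element outside the pure hull of that set. -/
theorem exists_pairsIntegrally {X B : Set BaerSpecker} (hX : X.Countable) (hB : B.Countable)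
    (hu : ∀ i, unitSeq i ∈ X) (y : BaerSpecker) :
    ∃ b, b ∉ B ∧ (∀ x ∈ X, PairsIntegrally b x) ∧ (y ∉ pureHull X → ¬ PairsIntegrally b y) := by
  -- Here `b` is the diagonal sequence and `X` supplies the functionals. One family of requirements
  -- keeps `b` out of `B`; the other, with integers encoded as constant sequences, excludes each `z`
  -- as the value of the pairing with `y`.
  let ψ : (ℕ →₀ ℤ) →ₗ[ℤ] BaerSpecker := LinearMap.pi fun _ => seqPairing y
  let R : Set (((ℕ →₀ ℤ) →ₗ[ℤ] BaerSpecker) × BaerSpecker) :=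
    (fun a => (finsuppToSeq, a)) '' insert 0 B ∪
      {r | y ∉ pureHull X ∧ ∃ z : ℤ, r = (ψ, fun _ => z)}
  have hR : R.Countable := by
    refine ((hB.insert 0).image _).union ((Set.countable_range
      fun z : ℤ => (ψ, (fun _ => z : BaerSpecker))).mono ?_)
    rintro _ ⟨-, z, rfl⟩
    exact ⟨z, rfl⟩
  obtain ⟨b, -, hb, hbR⟩ := exists_diagonal hX hR hu
    ⟨_, Or.inl ⟨0, Set.mem_insert _ _, rfl⟩⟩ (by
      rintro _ (⟨a, -, rfl⟩ | ⟨hy, z, rfl⟩) F hF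
      · obtain ⟨s, hs, hsF⟩ := exists_ne_zero_seqPairing_eq_zero F
        exact ⟨s, hsF, fun h => hs (Finsupp.ext fun i => congrFun h i)⟩
      · by_contra! h
        apply hy
        obtain ⟨n, hn, hny⟩ := exists_smul_mem_span F y fun s hs => congrFun (h s hs) 0
        exact ⟨n, hn, Submodule.span_mono hF hny⟩)
  refine ⟨b, fun hbB => ?_, fun x hx => (hb x hx).symm, ?_⟩
  · obtain ⟨p, c, -, ⟨d, hd⟩, hne⟩ := hbR _ (Or.inl ⟨b, Set.mem_insert_of_mem _ hbB, rfl⟩)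
    refine hne (-d) ?_
    simp only
    rw [hd, smul_neg]
    abel
  · rintro hy ⟨z, hz⟩
    obtain ⟨p, c, hc, ⟨d, hd⟩, hne⟩ := hbR _ (Or.inr ⟨hy, z, rfl⟩)
    obtain ⟨N, hN⟩ := hz c hc
    obtain ⟨N', hN'⟩ := seqPairing_eq_sum_range y p
    obtain ⟨v, hv⟩ : (c : ℤ) ∣ seqPairing y p - z := by
      rw [← hN' (max N N') (le_max_right _ _)]
      have h1 : (c : ℤ) ∣ ∑ i ∈ Finset.range (max N N'), b i * y i -
          ∑ i ∈ Finset.range (max N N'), y i * p i := by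
        rw [← Finset.sum_sub_distrib]
        refine Finset.dvd_sum fun i _ => ⟨y i * d i, ?_⟩
        rw [hd, Pi.add_apply, Pi.smul_apply, finsuppToSeq_apply, nsmul_eq_mul]
        ring
      have h2 := dvd_sub (hN (max N N') (le_max_left _ _)) h1
      rwa [sub_sub_sub_cancel_left, ← neg_sub, neg_sub] at h2
    refine hne (fun _ => v) (funext fun i => ?_)
    rw [Pi.sub_apply, Pi.smul_apply, nsmul_eq_mul]
    exact hv

/-! ### Endomorphisms determined by the unit vectors -/

/-- The homomorphism on finitely supported sequences with `eᵢ ↦ vᵢ` is not a rational scalar on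
any subgroup cut out by finitely many functionals. -/
def AvoidsScalars (v : ℕ → BaerSpecker) : Prop :=
  ∀ n m : ℤ, n ≠ 0 → ∀ F : Finset BaerSpecker, ∃ s, (∀ a ∈ F, seqPairing a s = 0) ∧
    n • Finsupp.linearCombination ℤ v s - m • finsuppToSeq s ≠ 0

/-- The endomorphism `f` of `H` sends the unit vectors to the sequences `vᵢ`. -/
def ExtendsUnitMap {H : AddSubgroup BaerSpecker} (f : H →+ H) (v : ℕ → BaerSpecker) : Prop :=
  ∀ (s : ℕ →₀ ℤ) (hs : finsuppToSeq s ∈ H),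
    (f ⟨finsuppToSeq s, hs⟩ : BaerSpecker) = Finsupp.linearCombination ℤ v s

theorem mem_of_eq_add_smul {H : AddSubgroup BaerSpecker} (hS : finSuppSubgroup ≤ H)
    (hH : IsPureIn H ⊤) {x d : BaerSpecker} {p : ℕ →₀ ℤ} {c : ℕ} (hc : 0 < c) (hx : x ∈ H)
    (h : x = finsuppToSeq p + c • d) : d ∈ H := by
  refine mem_of_isPureIn_top hH (n := c) (by exact_mod_cast hc.ne') ?_
  have h1 : c • d = x - finsuppToSeq p := by rw [h]; abel
  rw [natCast_zsmul, h1]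
  exact sub_mem hx (hS (mem_finSuppSubgroup_iff.2 ⟨p, rfl⟩))

theorem ExtendsUnitMap.apply_eq {H : AddSubgroup BaerSpecker} {f : H →+ H}
    {v : ℕ → BaerSpecker} (hf : ExtendsUnitMap f v) (hS : finSuppSubgroup ≤ H) {p : ℕ →₀ ℤ}
    {c : ℕ} {d : BaerSpecker} (hx : finsuppToSeq p + c • d ∈ H) (hd : d ∈ H) :
    (f ⟨_, hx⟩ : BaerSpecker) = Finsupp.linearCombination ℤ v p + c • (f ⟨d, hd⟩ : BaerSpecker) := by
  have hp : finsuppToSeq p ∈ H := hS (mem_finSuppSubgroup_iff.2 ⟨p, rfl⟩)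
  have : (⟨_, hx⟩ : H) = ⟨_, hp⟩ + c • ⟨d, hd⟩ := rfl
  rw [this, map_add, map_nsmul, AddSubgroup.coe_add, hf p hp, AddSubgroup.coe_nsmul]

/-- Modulo any `M`, both values are congruent to the image under `v` of the same finite
approximation of `x`. Different subgroups are allowed because the final group is unknown when the
value is needed. -/
theorem ExtendsUnitMap.unique {H H' : AddSubgroup BaerSpecker} {f : H →+ H} {f' : H' →+ H'}
    {v : ℕ → BaerSpecker} (hf : ExtendsUnitMap f v) (hf' : ExtendsUnitMap f' v)
    (hS : finSuppSubgroup ≤ H) (hS' : finSuppSubgroup ≤ H') (hH : IsPureIn H ⊤)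
    (hH' : IsPureIn H' ⊤) {x : BaerSpecker} (hx : x ∈ H) (hx' : x ∈ H')
    (hD : x ∈ zadicClosure finSuppSubgroup) :
    (f ⟨x, hx⟩ : BaerSpecker) = f' ⟨x, hx'⟩ := by
  rw [← sub_eq_zero]
  by_contra hne
  obtain ⟨M, hM, hv⟩ := exists_not_smul hne
  obtain ⟨p, d, rfl⟩ := mem_zadicClosure_iff.1 hD M hM
  have hd := mem_of_eq_add_smul hS hH hM hx rfl
  have hd' := mem_of_eq_add_smul hS' hH' hM hx' rfl
  refine hv (f ⟨d, hd⟩ - f' ⟨d, hd'⟩) ?_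
  rw [hf.apply_eq hS hx hd, hf'.apply_eq hS' hx' hd', smul_sub]
  abel

/-- Membership would give `n • f x = m • x + g` with `n ≠ 0` and `g` in the span of `X`. These are
countably many equations, each refuted modulo some `c` by the diagonal construction, whose
hypothesis is `AvoidsScalars`. -/
theorem exists_notMem_pureHull {v : ℕ → BaerSpecker} (hv : AvoidsScalars v)
    {X B : Set BaerSpecker} (hX : X.Countable) (hB : B.Countable) :
    ∃ x ∈ zadicClosure finSuppSubgroup, (∀ a ∈ B, PairsIntegrally a x) ∧
      ∀ (H : AddSubgroup BaerSpecker) (f : H →+ H) (hx : x ∈ H), finSuppSubgroup ≤ H →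
        IsPureIn H ⊤ → ExtendsUnitMap f v → (f ⟨x, hx⟩ : BaerSpecker) ∉ pureHull (insert x X) := by
  let ψ : ℤ → ℤ → (ℕ →₀ ℤ) →ₗ[ℤ] BaerSpecker := fun n m =>
    n • Finsupp.linearCombination ℤ v - m • finsuppToSeq
  let R : Set (((ℕ →₀ ℤ) →ₗ[ℤ] BaerSpecker) × BaerSpecker) :=
    {r | ∃ n m : ℤ, n ≠ 0 ∧ ∃ g ∈ Submodule.span ℤ X, r = (ψ n m, g)}
  have hspan : (Submodule.span ℤ X : Set BaerSpecker).Countable := by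
    have := hX.to_subtype
    have h1 : Submodule.span ℤ X =
        LinearMap.range (Finsupp.linearCombination ℤ ((↑) : X → BaerSpecker)) := by
      rw [Finsupp.range_linearCombination, Subtype.range_coe]
    rw [h1, LinearMap.coe_range]
    exact Set.countable_range _
  have hR : R.Countable := by
    refine (((Set.countable_univ (α := ℤ × ℤ)).prod hspan).image
      fun q => (ψ q.1.1 q.1.2, q.2)).mono ?_
    rintro _ ⟨n, m, -, g, hg, rfl⟩
    exact ⟨((n, m), g), ⟨trivial, hg⟩, rfl⟩
  obtain ⟨x, hxD, hxB, hxR⟩ := exists_diagonal (hB.union (Set.countable_range unitSeq)) hR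
    (fun i => Or.inr ⟨i, rfl⟩) ⟨_, 1, 0, one_ne_zero, 0, zero_mem _, rfl⟩ (by
      rintro _ ⟨n, m, hn, g, hg, rfl⟩ F -
      exact hv n m hn F)
  refine ⟨x, mem_zadicClosure_iff.2 hxD, fun a ha => hxB a (Or.inl ha), ?_⟩
  rintro H f hx hS hH hf ⟨n, hn, hmem⟩
  obtain ⟨m, g, hg, hmg⟩ := Submodule.mem_span_insert.1 hmem
  obtain ⟨p, c, hc, ⟨d, rfl⟩, hne⟩ := hxR _ ⟨n, m, hn, g, hg, rfl⟩
  have hd := mem_of_eq_add_smul hS hH hc hx rfl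
  refine hne (m • d - n • (f ⟨d, hd⟩ : BaerSpecker)) ?_
  rw [hf.apply_eq hS hx hd] at hmg
  simp only [ψ, LinearMap.sub_apply, LinearMap.smul_apply]
  rw [smul_sub, smul_comm c m, smul_comm c n, sub_sub, sub_eq_iff_eq_add]
  rw [smul_add, smul_add] at hmg
  rw [eq_sub_of_add_eq hmg]
  abel

/-! ### Transfinite construction -/

/-- One step of the transfinite construction. -/
theorem exists_step (v : ℕ → BaerSpecker) {X B : Set BaerSpecker} (hX : X.Countable)
    (hB : B.Countable) :
    ∃ q : BaerSpecker × BaerSpecker, q.1 ∈ zadicClosure finSuppSubgroup ∧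
      (∀ a ∈ B, PairsIntegrally a q.1) ∧ q.2 ∉ B ∧ (∀ x ∈ insert q.1 X, PairsIntegrally q.2 x) ∧
      (AvoidsScalars v → ∀ (H : AddSubgroup BaerSpecker) (f : H →+ H), q.1 ∈ H →
        finSuppSubgroup ≤ H → IsPureIn H ⊤ → (∀ h ∈ H, PairsIntegrally q.2 h) →
        ¬ ExtendsUnitMap f v) := by
  have hXu : (X ∪ Set.range unitSeq).Countable := hX.union (Set.countable_range _)
  by_cases hv : AvoidsScalars v
  · obtain ⟨x, hxD, hxB, hxf⟩ := exists_notMem_pureHull hv hXu hB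
    -- The image of `x` is fixed in advance of any group, so that `b` can be chosen against it.
    obtain ⟨y, hy⟩ : ∃ y : BaerSpecker, ∀ (H : AddSubgroup BaerSpecker) (f : H →+ H) (hx : x ∈ H),
        finSuppSubgroup ≤ H → IsPureIn H ⊤ → ExtendsUnitMap f v →
        (f ⟨x, hx⟩ : BaerSpecker) = y := by
      by_cases hex : ∃ (H : AddSubgroup BaerSpecker) (f : H →+ H) (_ : x ∈ H),
          finSuppSubgroup ≤ H ∧ IsPureIn H ⊤ ∧ ExtendsUnitMap f v
      · obtain ⟨H, f, hx, hS, hH, hf⟩ := hex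
        exact ⟨f ⟨x, hx⟩, fun H' f' hx' hS' hH' hf' => hf'.unique hf hS' hS hH' hH hx' hx hxD⟩
      · exact ⟨0, fun H f hx hS hH hf => (hex ⟨H, f, hx, hS, hH, hf⟩).elim⟩
    obtain ⟨b, hbB, hbX, hby⟩ := exists_pairsIntegrally (hXu.insert x) hB
      (fun i => Or.inr (Or.inr ⟨i, rfl⟩)) y
    refine ⟨(x, b), hxD, hxB, hbB, fun z hz => hbX z ?_, fun _ H f hx hS hH hbH hf => ?_⟩
    · exact Set.insert_subset_insert Set.subset_union_left hz
    · have hfx := hy H f hx hS hH hf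
      exact hby (hfx ▸ hxf H f hx hS hH hf) (hfx ▸ hbH _ (f ⟨x, hx⟩).2)
  · obtain ⟨b, hbB, hbX, -⟩ := exists_pairsIntegrally (hXu.insert 0) hB
      (fun i => Or.inr (Or.inr ⟨i, rfl⟩)) 0
    refine ⟨(0, b), zero_mem _, fun a _ => (integralSubgroup a).zero_mem, hbB,
      fun z hz => hbX z ?_, fun h => (hv h).elim⟩
    exact Set.insert_subset_insert Set.subset_union_left hz

theorem exists_countable_wellOrder {I : Type} (hI : Cardinal.mk I = Cardinal.aleph 1) :
    ∃ r : I → I → Prop, IsWellOrder I r ∧ ∀ i, {j | r j i}.Countable := by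
  obtain ⟨r, hr, htype⟩ := Cardinal.exists_ord_eq I
  refine ⟨r, hr, fun i => ?_⟩
  have := Cardinal.card_typein_lt i htype
  rw [hI, Ordinal.card_typein, ← Cardinal.succ_aleph0, Order.lt_succ_iff] at this
  exact Cardinal.mk_le_aleph0_iff.1 this

/-- The outcome of the transfinite construction: sequences `xᵢ` in the closure and functionals
`bᵢ`, all pairing integrally, such that the `i`-th pair obstructs the `i`-th unit map. -/
theorem exists_family (CH : Cardinal.continuum.{0} = Cardinal.aleph.{0} 1) :
    ∃ x b : (ℕ → BaerSpecker) → BaerSpecker,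
      (∀ v, x v ∈ zadicClosure finSuppSubgroup) ∧ Function.Injective b ∧
      (∀ v w, PairsIntegrally (b v) (x w)) ∧
      ∀ v, AvoidsScalars v → ∀ (H : AddSubgroup BaerSpecker) (f : H →+ H), x v ∈ H →
        finSuppSubgroup ≤ H → IsPureIn H ⊤ → (∀ h ∈ H, PairsIntegrally (b v) h) →
        ¬ ExtendsUnitMap f v := by
  obtain ⟨r, hr, hcount⟩ := exists_countable_wellOrder (I := ℕ → BaerSpecker) (by
    rw [← CH]; simp [BaerSpecker])
  have hc : ∀ (v : ℕ → BaerSpecker) (g : ∀ w, r w v → BaerSpecker × BaerSpecker)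
      (π : BaerSpecker × BaerSpecker → BaerSpecker),
      (Set.range fun w : {w // r w v} => π (g w.1 w.2)).Countable := fun v g π => by
    have : Countable {w // r w v} := (hcount v).to_subtype
    exact Set.countable_range _
  choose Q hQ using fun (v : ℕ → BaerSpecker) (g : ∀ w, r w v → BaerSpecker × BaerSpecker) =>
    exists_step v (hc v g Prod.fst) (hc v g Prod.snd)
  let q : (ℕ → BaerSpecker) → BaerSpecker × BaerSpecker := hr.wf.fix Q
  have hq : ∀ v, q v = Q v fun w _ => q w := fun v => hr.wf.fix_eq Q v
  have hspec := fun v => hQ v fun w _ => q w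
  simp only [← hq] at hspec
  refine ⟨fun v => (q v).1, fun v => (q v).2, fun v => (hspec v).1, ?_, ?_,
    fun v => (hspec v).2.2.2.2⟩
  · have hne : ∀ v w, r w v → (q v).2 ≠ (q w).2 := fun v w h heq =>
      (hspec v).2.2.1 ⟨⟨w, h⟩, heq.symm⟩
    intro v w hvw
    by_contra hvw'
    rcases trichotomous_of r v w with h | h | h
    exacts [hne w v h hvw.symm, hvw' h, hne v w h hvw]
  · intro v w
    -- Whichever index is later takes care of the pairing: a new `x` respects earlier `b`, and a new
    -- `b` respects earlier `x` and its own.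
    rcases trichotomous_of r v w with h | rfl | h
    · exact (hspec w).2.1 _ ⟨⟨v, h⟩, rfl⟩
    · exact (hspec v).2.2.2.1 _ (Set.mem_insert _ _)
    · exact (hspec v).2.2.2.1 _ (Set.mem_insert_of_mem _ ⟨⟨w, h⟩, rfl⟩)

/-! ### Finite rank and almost scalar endomorphisms -/

theorem rank_lt_aleph0_of_smul_mem {V : Type*} [AddCommGroup V] {N E : Submodule ℤ V}
    (hE : E.FG) (h : ∀ y ∈ N, ∃ n : ℤ, n ≠ 0 ∧ n • y ∈ E) : Module.rank ℤ N < Cardinal.aleph0 := by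
  have : Module.Finite ℤ E := Module.Finite.iff_fg.2 hE
  let E' : Submodule ℤ N := E.comap N.subtype
  have h1 : Module.rank ℤ E' ≤ Module.rank ℤ E :=
    LinearMap.rank_le_of_injective ((N.subtype.comp E'.subtype).codRestrict E fun y => y.2)
      fun a b hab => Subtype.ext (Subtype.ext (congrArg (fun y : E => (y : V)) hab))
  have h2 : Module.rank ℤ (N ⧸ E') = 0 := by
    rw [rank_eq_zero_iff]
    intro y
    obtain ⟨y, rfl⟩ := E'.mkQ_surjective y
    obtain ⟨n, hn, hny⟩ := h y y.2
    refine ⟨n, hn, ?_⟩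
    rw [← map_smul, Submodule.mkQ_apply, Submodule.Quotient.mk_eq_zero]
    exact hny
  rw [← E'.rank_quotient_add_rank, h2, zero_add]
  exact h1.trans_lt (Module.rank_lt_aleph0 ..)

theorem seqPairing_add_left (a b : BaerSpecker) (s : ℕ →₀ ℤ) :
    seqPairing (a + b) s = seqPairing a s + seqPairing b s := by
  induction s using Finsupp.induction_linear with
  | zero => simp
  | add f g hf hg => rw [map_add, map_add, map_add, hf, hg, add_add_add_comm]
  | single j c => simp [mul_add]

theorem seqPairing_smul_left (n : ℤ) (a : BaerSpecker) (s : ℕ →₀ ℤ) :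
    seqPairing (n • a) s = n • seqPairing a s := by
  induction s using Finsupp.induction_linear with
  | zero => simp
  | add f g hf hg => rw [map_add, map_add, hf, hg, smul_add]
  | single j c => simp [mul_left_comm]

/-- Evaluation of functionals at a fixed finitely supported sequence. -/
noncomputable def evalAt (s : ℕ →₀ ℤ) : BaerSpecker →ₗ[ℤ] ℤ where
  toFun a := seqPairing a s
  map_add' a b := seqPairing_add_left a b s
  map_smul' n a := seqPairing_smul_left n a s

/-- The map factors through the quotient by the common kernel of `F`, which embeds in a finitely
generated free group. -/
theorem fg_range_of_ker {V : Type*} [AddCommGroup V] (ψ : (ℕ →₀ ℤ) →ₗ[ℤ] V)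
    (F : Finset BaerSpecker) (h : ∀ s, (∀ a ∈ F, seqPairing a s = 0) → ψ s = 0) :
    (LinearMap.range ψ).FG := by
  let L : (ℕ →₀ ℤ) →ₗ[ℤ] (F → ℤ) := LinearMap.pi fun a => seqPairing a
  have hL : LinearMap.ker L ≤ LinearMap.ker ψ := fun s hs =>
    h s fun a ha => congrFun (LinearMap.mem_ker.1 hs) ⟨a, ha⟩
  have : Module.Finite ℤ ((ℕ →₀ ℤ) ⧸ LinearMap.ker L) :=
    Module.Finite.equiv L.quotKerEquivRange.symm
  rw [← Submodule.range_liftQ _ ψ hL]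
  exact Module.Finite.iff_fg.1 inferInstance

/-- The inclusion of the finitely supported sequences into a subgroup containing them. -/
noncomputable def finsuppToSubgroup {H : AddSubgroup BaerSpecker} (hS : finSuppSubgroup ≤ H) :
    (ℕ →₀ ℤ) →ₗ[ℤ] H :=
  LinearMap.codRestrict (AddSubgroup.toIntSubmodule H) finsuppToSeq fun s =>
    hS (mem_finSuppSubgroup_iff.2 ⟨s, rfl⟩)

theorem coe_finsuppToSubgroup {H : AddSubgroup BaerSpecker} (hS : finSuppSubgroup ≤ H)
    (s : ℕ →₀ ℤ) : (finsuppToSubgroup hS s : BaerSpecker) = finsuppToSeq s := rfl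

theorem finsuppToSubgroup_injective {H : AddSubgroup BaerSpecker} (hS : finSuppSubgroup ≤ H) :
    Function.Injective (finsuppToSubgroup hS) := fun _ _ h =>
  Finsupp.ext fun i => congrFun (congrArg Subtype.val h) i

theorem exists_extendsUnitMap {H : AddSubgroup BaerSpecker} (hS : finSuppSubgroup ≤ H)
    (f : H →+ H) : ∃ v, ExtendsUnitMap f v := by
  let ψ : (ℕ →₀ ℤ) →ₗ[ℤ] BaerSpecker :=
    (H.subtype.comp f).toIntLinearMap.comp (finsuppToSubgroup hS)
  refine ⟨fun i => ψ (Finsupp.single i 1), fun s hs => ?_⟩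
  have : ψ = Finsupp.linearCombination ℤ fun i => ψ (Finsupp.single i 1) := by
    ext1 i
    ext1
    simp
  rw [← this]
  rfl

/-- An endomorphism vanishing on the finitely supported sequences annihilated by finitely many
functionals has finite rank. -/
theorem hasFiniteRank_of_ker {H : AddSubgroup BaerSpecker} (hS : finSuppSubgroup ≤ H)
    (hD : H ≤ zadicClosure finSuppSubgroup) (hH : IsPureIn H ⊤) (f : H →+ H)
    (F : Finset BaerSpecker) (h : ∀ s, (∀ a ∈ F, seqPairing a s = 0) →
      f (finsuppToSubgroup hS s) = 0) : HasFiniteRank f := by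
  obtain ⟨v, hv⟩ := exists_extendsUnitMap hS f
  have hvs : ∀ s, Finsupp.linearCombination ℤ v s = f (finsuppToSubgroup hS s) := fun s =>
    (hv s (finsuppToSubgroup hS s).2).symm
  obtain ⟨W, hW⟩ := fg_range_of_ker (Finsupp.linearCombination ℤ v) F fun s hs => by
    rw [hvs, h s hs]; rfl
  let φ : H →ₗ[ℤ] BaerSpecker := (H.subtype.comp f).toIntLinearMap
  have hφ : Module.rank ℤ (LinearMap.range φ) < Cardinal.aleph0 := by
    refine rank_lt_aleph0_of_smul_mem (E := Submodule.span ℤ W) ⟨W, rfl⟩ ?_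
    rintro _ ⟨⟨x, hx⟩, rfl⟩
    -- A functional `t` killing the image of `S` kills `f x`: modulo every `M`, `f x` is the image
    -- of an element of `S`.
    refine exists_smul_mem_span W _ fun t ht => eq_zero_of_forall_dvd fun M hM => ?_
    obtain ⟨p, d, rfl⟩ := mem_zadicClosure_iff.1 (hD hx) M hM
    have hd := mem_of_eq_add_smul hS hH hM hx rfl
    have h1 : φ ⟨_, hx⟩ = _ := hv.apply_eq hS hx hd
    have h2 : evalAt t (Finsupp.linearCombination ℤ v p) = 0 := by
      have : Submodule.span ℤ (W : Set BaerSpecker) ≤ LinearMap.ker (evalAt t) :=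
        Submodule.span_le.2 ht
      exact this (hW ▸ LinearMap.mem_range_self _ p)
    change (M : ℤ) ∣ evalAt t (φ _)
    rw [h1, map_add, h2, zero_add, map_nsmul, nsmul_eq_mul]
    exact dvd_mul_right _ _
  refine lt_of_le_of_lt (LinearMap.rank_le_of_injective
    ((H.subtype.toIntLinearMap.comp (LinearMap.range f.toIntLinearMap).subtype).codRestrict
      (LinearMap.range φ) ?_) ?_) hφ
  · rintro ⟨_, ⟨x, rfl⟩⟩
    exact ⟨x, rfl⟩
  · intro a b hab
    exact Subtype.ext (Subtype.ext
      (congrArg (fun y : LinearMap.range φ => (y : BaerSpecker)) hab))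

/-- The rational scalar `m / n` is an integer because the common kernel contains a primitive vector
`t`, a nonzero element divided by its gcd: `n` divides every coordinate of `m • t`, hence `m`. -/
theorem exists_scalar_of_not_avoidsScalars {v : ℕ → BaerSpecker} (hv : ¬ AvoidsScalars v) :
    ∃ (z : ℤ) (F : Finset BaerSpecker), ∀ s, (∀ a ∈ F, seqPairing a s = 0) →
      Finsupp.linearCombination ℤ v s = z • finsuppToSeq s := by
  simp only [AvoidsScalars, not_forall, not_exists, not_and, not_not] at hv
  obtain ⟨n, m, hn, F, hF⟩ := hv
  obtain ⟨s, hs, hsF⟩ := exists_ne_zero_seqPairing_eq_zero F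
  obtain ⟨g, hg, hg1⟩ := s.support.extract_gcd s (Finsupp.support_nonempty_iff.2 hs)
  set c := s.support.gcd s with hc
  have hc0 : c ≠ 0 := by
    rintro h0
    apply hs
    ext i
    by_contra hi
    have := hg i (Finsupp.mem_support_iff.2 hi)
    rw [h0, zero_mul] at this
    exact hi this
  classical
  let t : ℕ →₀ ℤ := Finsupp.onFinset s.support (fun i => if i ∈ s.support then g i else 0)
    (by aesop)
  have hst : s = c • t := by
    ext i
    rw [Finsupp.smul_apply, smul_eq_mul, Finsupp.onFinset_apply]
    split_ifs with hi
    · exact hg i hi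
    · rw [mul_zero]; exact Finsupp.notMem_support_iff.1 hi
  have htF : ∀ a ∈ F, seqPairing a t = 0 := fun a ha => by
    have := hsF a ha
    rw [hst, map_smul, smul_eq_mul] at this
    exact (mul_eq_zero.1 this).resolve_left hc0
  have hdvd : n ∣ m := by
    have h1 : ∀ i ∈ s.support, n ∣ m * g i := fun i hi => by
      have := congrFun (sub_eq_zero.1 (hF t htF)) i
      rw [Pi.smul_apply, Pi.smul_apply, finsuppToSeq_apply, Finsupp.onFinset_apply, if_pos hi,
        smul_eq_mul, smul_eq_mul] at this
      exact ⟨_, this.symm⟩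
    have h2 := Finset.dvd_gcd h1
    rw [Finset.gcd_mul_left, hg1, mul_one] at h2
    exact dvd_normalize_iff.1 h2
  obtain ⟨z, rfl⟩ := hdvd
  refine ⟨z, F, fun s hs => ?_⟩
  have := sub_eq_zero.1 (hF s hs)
  rw [mul_smul] at this
  exact smul_right_injective _ hn this

theorem not_hasFiniteRank_of_injective {G : Type} [AddCommGroup G] (f : G →+ G)
    (j : (ℕ →₀ ℤ) →+ G) (h : Function.Injective (f.comp j)) : ¬ HasFiniteRank f := by
  intro hf
  have h1 := LinearMap.rank_le_of_injective
    ((f.comp j).toIntLinearMap.codRestrict (LinearMap.range f.toIntLinearMap)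
      fun s => ⟨j s, rfl⟩) fun a b hab => h (congrArg Subtype.val hab)
  rw [rank_finsupp_self'] at h1
  exact absurd (h1.trans_lt hf) (by simp)

theorem endEqIntSumFin_of_isAlmostScalar {G : Type} [AddCommGroup G] [IsAddTorsionFree G]
    (j : (ℕ →₀ ℤ) →+ G) (hj : Function.Injective j)
    (h : ∀ f : AddMonoid.End G, IsAlmostScalar f) : EndEqIntSumFin G := by
  have key : ∀ z : ℤ, ((z : AddMonoid.End G) ∈ finEnd G) → z = 0 := by
    intro z hz
    by_contra hz0
    refine not_hasFiniteRank_of_injective (z : AddMonoid.End G) j (fun a b hab => hj ?_) hz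
    have : z • j a = z • j b := hab
    exact zsmul_right_injective hz0 this
  refine ⟨?_, ?_, ?_⟩
  · rw [injective_iff_map_eq_zero]
    intro z hz
    refine key z ?_
    have : (z : AddMonoid.End G) = 0 := hz
    rw [this]
    exact zero_mem _
  · rw [AddSubgroup.disjoint_def]
    rintro _ ⟨z, rfl⟩ hz
    have := key z hz
    subst this
    exact map_zero _
  · rw [codisjoint_iff, eq_top_iff]
    intro f _
    obtain ⟨z, hz⟩ := h f
    rw [← add_sub_cancel (z : AddMonoid.End G) f]
    exact AddSubgroup.add_mem_sup ⟨z, rfl⟩ hz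

/-! ### No summand isomorphic to `S`, and the dual -/

/-- `S` as the group of finitely supported functions. -/
noncomputable def finSuppEquiv : (ℕ →₀ ℤ) ≃+ finSuppSubgroup :=
  AddEquiv.ofBijective (finsuppToSubgroup le_rfl).toAddMonoidHom
    ⟨finsuppToSubgroup_injective le_rfl, fun ⟨_, hx⟩ =>
      (mem_finSuppSubgroup_iff.1 hx).imp fun _ hs => Subtype.ext hs⟩

theorem shift_sub_smul_injective (z : ℤ) :
    Function.Injective fun s : ℕ →₀ ℤ => Finsupp.mapDomain Nat.succ s - z • s := by
  have hadd : ∀ s t : ℕ →₀ ℤ, Finsupp.mapDomain Nat.succ s - z • s =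
      Finsupp.mapDomain Nat.succ t - z • t → ∀ i, (s - t) i = 0 := by
    intro s t h
    have h0 : Finsupp.mapDomain Nat.succ (s - t) = z • (s - t) := by
      have : Finsupp.mapDomain Nat.succ (s - t) =
          Finsupp.mapDomain Nat.succ s - Finsupp.mapDomain Nat.succ t :=
        map_sub (Finsupp.mapDomain.addMonoidHom Nat.succ) s t
      rw [this, smul_sub]
      rw [sub_eq_sub_iff_add_eq_add] at h
      rw [sub_eq_sub_iff_add_eq_add, h]
      abel
    generalize s - t = u at h0
    -- An eigenvector `u` of the shift satisfies `u i = z * u (i + 1)` and `z * u 0 = 0`, hence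
    -- vanishes coordinate by coordinate.
    have hsucc : ∀ i, u i = z * u (i + 1) := fun i => by
      rw [← Finsupp.mapDomain_apply Nat.succ_injective u i, h0]
      rfl
    have hzero : 0 = z * u 0 := by
      have := DFunLike.congr_fun h0 0
      rwa [Finsupp.mapDomain_of_notMem_range _ _ (by simp)] at this
    intro i
    induction i with
    | zero =>
      rcases mul_eq_zero.1 hzero.symm with rfl | h
      · rw [hsucc, zero_mul]
      · exact h
    | succ i ih =>
      rw [hsucc i] at ih
      rcases mul_eq_zero.1 ih with rfl | h
      · rw [hsucc, zero_mul]
      · exact h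
  exact fun s t h => sub_eq_zero.1 (Finsupp.ext (hadd s t h))

/-- Project to the summand and shift there: minus any integer, this endomorphism is injective on the
summand, so its rank is infinite. -/
theorem not_hasSummandIso_of_isAlmostScalar {G : Type} [AddCommGroup G]
    (h : ∀ f : AddMonoid.End G, IsAlmostScalar f) : ¬ HasSummandIso G finSuppSubgroup := by
  rintro ⟨A, C, hAC, ⟨e⟩⟩
  let e' : A ≃+ (ℕ →₀ ℤ) := e.trans finSuppEquiv.symm
  let π : G →ₗ[ℤ] A := Submodule.projectionOnto (AddSubgroup.toIntSubmodule A)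
    (AddSubgroup.toIntSubmodule C) (hAC.map AddSubgroup.toIntSubmodule)
  let j : (ℕ →₀ ℤ) →+ G := A.subtype.comp e'.symm.toAddMonoidHom
  let f : AddMonoid.End G := j.comp ((Finsupp.mapDomain.addMonoidHom Nat.succ).comp
    (e'.toAddMonoidHom.comp π.toAddMonoidHom))
  have hj : Function.Injective j := Subtype.val_injective.comp e'.symm.injective
  have hfj : ∀ s, f (j s) = j (Finsupp.mapDomain Nat.succ s) := fun s => by
    have : π (j s) = e'.symm s :=
      Submodule.projectionOnto_apply_left (p := AddSubgroup.toIntSubmodule A) _ (e'.symm s)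
    change j (Finsupp.mapDomain Nat.succ (e' (π (j s)))) = _
    rw [this, e'.apply_symm_apply]
  obtain ⟨z, hz⟩ := h f
  refine not_hasFiniteRank_of_injective (f - (z : AddMonoid.End G)) j (fun s t hst => ?_) hz
  have hval : ∀ s, (f - (z : AddMonoid.End G)) (j s) = j (Finsupp.mapDomain Nat.succ s - z • s) :=
    fun s => by
      rw [map_sub, map_zsmul, ← hfj]
      rfl
  apply shift_sub_smul_injective z
  apply hj
  rw [← hval, ← hval]
  exact hst

/-- The functional induced by a sequence pairing integrally with every element of `H`. -/
theorem exists_hom_of_pairsIntegrally {H : AddSubgroup BaerSpecker} {b : BaerSpecker}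
    (h : ∀ x ∈ H, PairsIntegrally b x) : ∃ l : H →+ ℤ, ∀ x : H, ∀ M : ℕ, 0 < M → ∃ N, ∀ n ≥ N,
      (M : ℤ) ∣ ∑ i ∈ Finset.range n, b i * (x : BaerSpecker) i - l x := by
  choose l hl using fun x : H => h x x.2
  refine ⟨AddMonoidHom.mk' l fun x y => ?_, hl⟩
  rw [← sub_eq_zero]
  refine eq_zero_of_forall_dvd fun M hM => ?_
  obtain ⟨N₁, h₁⟩ := hl x M hM
  obtain ⟨N₂, h₂⟩ := hl y M hM
  obtain ⟨N₃, h₃⟩ := hl (x + y) M hM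
  let n := N₁ + N₂ + N₃
  have hsum : ∑ i ∈ Finset.range n, b i * ((x + y : H) : BaerSpecker) i =
      ∑ i ∈ Finset.range n, b i * (x : BaerSpecker) i +
        ∑ i ∈ Finset.range n, b i * (y : BaerSpecker) i := by
    rw [← Finset.sum_add_distrib]
    exact Finset.sum_congr rfl fun i _ => mul_add _ _ _
  have := dvd_sub (dvd_add (h₁ n (by omega)) (h₂ n (by omega))) (h₃ n (by omega))
  rw [hsum, ← add_sub_add_comm, sub_sub_sub_cancel_left] at this
  exact this

/-- The functional given by `b i` takes the value `b i k` at the `k`-th unit vector, so it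
determines `b i`. -/
theorem uncountable_dual {I : Type} [Uncountable I] {H : AddSubgroup BaerSpecker}
    (hS : finSuppSubgroup ≤ H) {b : I → BaerSpecker} (hb : Function.Injective b)
    (h : ∀ i, ∀ x ∈ H, PairsIntegrally (b i) x) : Uncountable (H →+ ℤ) := by
  choose l hl using fun i => exists_hom_of_pairsIntegrally (h i)
  have hval : ∀ i k, l i (finsuppToSubgroup hS (Finsupp.single k 1)) = b i k := by
    intro i k
    refine (sub_eq_zero.1 (eq_zero_of_forall_dvd fun M hM => ?_)).symm
    obtain ⟨N, hN⟩ := hl i (finsuppToSubgroup hS (Finsupp.single k 1)) M hM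
    obtain ⟨N', hN'⟩ := seqPairing_eq_sum_range (b i) (Finsupp.single k 1)
    have h1 := hN (max N N') (le_max_left _ _)
    simp only [coe_finsuppToSubgroup, finsuppToSeq_apply] at h1
    rwa [hN' _ (le_max_right _ _), seqPairing_single, one_mul] at h1
  refine Function.Injective.uncountable (f := l) fun i i' hii => hb (funext fun k => ?_)
  rw [← hval, ← hval, hii]

theorem mainTheorem1 (CH : Cardinal.continuum.{0} = Cardinal.aleph.{0} 1) :
    ∃ G : AddSubgroup BaerSpecker,
      finSuppSubgroup ≤ G ∧ G ≤ zadicClosure finSuppSubgroup ∧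
      IsPureIn G (zadicClosure finSuppSubgroup) ∧ IsPureIn G ⊤ ∧
      (∀ f : AddMonoid.End G, IsAlmostScalar f) ∧ EndEqIntSumFin G ∧
      Uncountable (G →+ ℤ) ∧
      ¬ HasSummandIso G finSuppSubgroup ∧
      ¬ Nonempty ((G →+ ℤ) ≃+ finSuppSubgroup) := by
  obtain ⟨x, b, hxD, hb, hbx, hf⟩ := exists_family CH
  let G := pureHull (Set.range unitSeq ∪ Set.range x)
  have hS : finSuppSubgroup ≤ G := fun y hy => by
    obtain ⟨s, rfl⟩ := mem_finSuppSubgroup_iff.1 hy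
    exact finsuppToSeq_mem (fun i => subset_pureHull _ (Or.inl ⟨i, rfl⟩)) s
  have hD : G ≤ zadicClosure finSuppSubgroup := pureHull_le_zadicClosure <| by
    rintro _ (⟨i, rfl⟩ | ⟨v, rfl⟩)
    · refine mem_zadicClosure_iff.2 fun n _ => ⟨Finsupp.single i 1, 0, funext fun k => ?_⟩
      simp [unitSeq, Pi.single_apply, Finsupp.single_apply, eq_comm]
    · exact hxD v
  have hP : IsPureIn G ⊤ := isPureIn_pureHull le_top
  have hint : ∀ v, ∀ g ∈ G, PairsIntegrally (b v) g := fun v => pureHull_pairsIntegrally <| by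
    rintro _ (⟨i, rfl⟩ | ⟨w, rfl⟩)
    exacts [pairsIntegrally_unitSeq _ i, hbx v w]
  have halmost : ∀ f : AddMonoid.End G, IsAlmostScalar f := by
    intro f
    obtain ⟨v, hv⟩ := exists_extendsUnitMap hS f
    -- `G` contains the `x v` of this very `v`, and `b v` is integral on `G`, so stage `v` rules `f`
    -- out.
    have hns : ¬ AvoidsScalars v := fun hav =>
      hf v hav G f (subset_pureHull _ (Or.inr ⟨v, rfl⟩)) hS hP (hint v) hv
    obtain ⟨z, F, hF⟩ := exists_scalar_of_not_avoidsScalars hns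
    refine ⟨z, hasFiniteRank_of_ker hS hD hP (f - (z : AddMonoid.End G)) F fun s hs => ?_⟩
    have h1 : f (finsuppToSubgroup hS s) = z • finsuppToSubgroup hS s :=
      Subtype.ext ((hv s (finsuppToSubgroup hS s).2).trans (hF s hs))
    have h2 : (z : AddMonoid.End G) (finsuppToSubgroup hS s) = z • finsuppToSubgroup hS s := by
      simp
    exact sub_eq_zero.2 (h1.trans h2.symm)
  have hunc : Uncountable (ℕ → BaerSpecker) := by
    rw [← Cardinal.aleph0_lt_mk_iff]
    simp [BaerSpecker, Cardinal.aleph0_lt_continuum]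
  have hdual : Uncountable (G →+ ℤ) := uncountable_dual hS hb hint
  refine ⟨G, hS, hD, isPureIn_pureHull hD, hP, halmost,
    endEqIntSumFin_of_isAlmostScalar (finsuppToSubgroup hS).toAddMonoidHom
      (finsuppToSubgroup_injective hS) halmost,
    hdual, not_hasSummandIso_of_isAlmostScalar halmost, ?_⟩
  rintro ⟨e⟩
  have : Countable (G →+ ℤ) := (e.trans finSuppEquiv.symm).injective.countable
  exact not_countable this
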